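/- A \emph{mixed graph} $G=(V;D,L)$ consists of a finite nonempty vertex set $V$, a set $D$ of direction edges and a set $L$ of length edges; there are no loops, and parallel edges occur only as one direction edge together with one length edge. For $p,q:V\to\mathbb{R}^2$, the framework $(G,q)$ is \emph{equivalent} to $(G,p)$ if $p(u)-p(v)$ is a scalar multiple of $q(u)-q(v)$ for all $uv\in D$ with $q(u)\ne q(v)$, and $\|p(u)-p(v)\|=\|q(u)-q(v)\|$ for all $uv\in L$; $p$ and $q$ are \emph{congruent} if $p(u)-p(v)=q(u)-q(v)$ for all $u,v\in V$, or $p(u)-p(v)=q(v)-q(u)$ for all $u,v\in V$. The framework $(G,p)$ is \emph{rigid} if there is $\varepsilon>0$ such that $p$ is congruent to $q$ whenever $(G,q)$ is equivalent to $(G,p)$ and $\|p(v)-q(v)\|<\varepsilon$ for all $v\in V$. It is \emph{generic} if the coordinates of the points $p(v)$, $v\in V$, are algebraically independent over $\mathbb{Q}$. The graph $G$ is \emph{rigid} if some generic realisation $(G,p)$ is rigid. The \emph{rigidity matrix} $R(G,p)$ has one row for each edge and two columns for each vertex; if the edge $e$ is oriented from $u$ to $v$ and $p(u)-p(v)=(a,b)$,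 then its row is $(a,b)$ at $u$ and $(-a,-b)$ at $v$ if $e\in L$, is $(b,-a)$ at $u$ and $(-b,a)$ at $v$ if $e\in D$, and is zero elsewhere. The \emph{rigidity matroid} $M(G)$ on $D\cup L$ is the row matroid of $R(G,p)$ for generic $p$. The graph $G$ is \emph{direction-independent} if $D$ is independent in $M(G)$. $G$ is \emph{direction reducible} to a subgraph $H$ if either (R1) $H=G-e$ for some $e\in D$ that belongs to a circuit of $M(G)$ consisting of direction edges only, or (R2) $H$ is a proper induced subgraph of $G$, and the multigraph $G/H$, obtained from $G$ by contracting $H$ to a single vertex (deleting all edges of $H$ and keeping all other edges of $G$, possibly as parallel edges), has only direction edges and is the union of two edge-disjoint spanning trees. \textbf{Lemma.} Let $G=(V;D,L)$ be a rigid, direction-independent mixed graph and let $H=(V';D',L')$ be an induced proper subgraph of $G$. Then $G$ is direction reducible to $H$ if and only if $L'=L$ and $|D\setminus D'|=2|V\setminus V'|$. -/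

import Mathlib

/-- The plane with its Euclidean norm. -/
abbrev Plane : Type := EuclideanSpace ℝ (Fin 2)

/-- A finite mixed graph `(V; D, L)` with vertices in `α`: a nonempty finite vertex set `V`, a set
`D` of direction edges and a set `L` of length edges. There are no loops, and parallel edges occur
only as one direction edge together with one length edge. -/
@[ext]
structure MixedGraph (α : Type*) where
  /-- the vertex set -/
  V : Finset α
  /-- the direction edges -/
  D : Finset (Sym2 α)
  /-- the length edges -/
  L : Finset (Sym2 α)
  nonempty : V.Nonempty
  dir_not_isDiag : ∀ e ∈ D, ¬ e.IsDiag
  len_not_isDiag : ∀ e ∈ L, ¬ e.IsDiag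
  dir_ends : ∀ e ∈ D, ∀ v ∈ e, v ∈ V
  len_ends : ∀ e ∈ L, ∀ v ∈ e, v ∈ V

namespace MixedGraph

/-- Labels of edges: `Sum.inl s(u, v)` is a direction edge and `Sum.inr s(u, v)` is a length edge
between `u` and `v`. -/
abbrev Edge (α : Type*) : Type _ := Sym2 α ⊕ Sym2 α

/-- The underlying set of end vertices of an edge. -/
def Edge.ends {α : Type*} : Edge α → Sym2 α := Sum.elim id id

/-- The edge set `D ∪ L` (as a disjoint union). -/
def edges {α : Type*} (G : MixedGraph α) : Finset (Edge α) := G.D.disjSum G.L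

/-- `G - e` for a direction edge `e`. -/
def deleteDir {α : Type*} [DecidableEq α] (G : MixedGraph α) (e : Sym2 α) : MixedGraph α where
  V := G.V
  D := G.D.erase e
  L := G.L
  nonempty := G.nonempty
  dir_not_isDiag f hf := G.dir_not_isDiag f (Finset.mem_of_mem_erase hf)
  len_not_isDiag := G.len_not_isDiag
  dir_ends f hf := G.dir_ends f (Finset.mem_of_mem_erase hf)
  len_ends := G.len_ends

/-- `H` is an induced subgraph of `G`: its vertices are vertices of `G`, and its edges are exactly
the edges of `G` with both ends in the vertex set of `H`. -/
structure IsInducedSubgraph {α : Type*} (H G : MixedGraph α) : Prop where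
  verts_subset : H.V ⊆ G.V
  mem_dir_iff : ∀ e, e ∈ H.D ↔ e ∈ G.D ∧ ∀ v ∈ e, v ∈ H.V
  mem_len_iff : ∀ e, e ∈ H.L ↔ e ∈ G.L ∧ ∀ v ∈ e, v ∈ H.V

/-- `H` is an induced subgraph of `G` different from `G`. -/
def IsProperInducedSubgraph {α : Type*} (H G : MixedGraph α) : Prop :=
  H.IsInducedSubgraph G ∧ H ≠ G

/-! ### Frameworks

A realisation of `G` is given by a map `p : α → Plane`, of which only the values on `G.V` matter. -/

/-- The frameworks `(G, p)` and `(G, q)` are equivalent. -/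
def Equivalent {α : Type*} (G : MixedGraph α) (p q : α → Plane) : Prop :=
  (∀ u v, s(u, v) ∈ G.D → q u ≠ q v → ∃ c : ℝ, p u - p v = c • (q u - q v)) ∧
  (∀ u v, s(u, v) ∈ G.L → ‖p u - p v‖ = ‖q u - q v‖)

/-- The point configurations `p` and `q` for the vertex set of `G` are congruent. -/
def Congruent {α : Type*} (G : MixedGraph α) (p q : α → Plane) : Prop :=
  (∀ u ∈ G.V, ∀ v ∈ G.V, p u - p v = q u - q v) ∨
  (∀ u ∈ G.V, ∀ v ∈ G.V, p u - p v = q v - q u)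

/-- The framework `(G, p)` is rigid. -/
def IsRigidFramework {α : Type*} (G : MixedGraph α) (p : α → Plane) : Prop :=
  ∃ ε : ℝ, 0 < ε ∧ ∀ q : α → Plane,
    G.Equivalent p q → (∀ v ∈ G.V, ‖p v - q v‖ < ε) → G.Congruent p q

/-- The framework `(G, p)` is generic: the coordinates of the points `p v`, `v ∈ V`, are
algebraically independent over `ℚ`. -/
def IsGeneric {α : Type*} (G : MixedGraph α) (p : α → Plane) : Prop :=
  AlgebraicIndependent ℚ (fun x : G.V × Fin 2 => p (x.1 : α) x.2)

/-- The mixed graph `G` is rigid: some generic realisation of `G` is rigid. -/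
def IsRigid {α : Type*} (G : MixedGraph α) : Prop :=
  ∃ p : α → Plane, G.IsGeneric p ∧ G.IsRigidFramework p

/-! ### The rigidity matroid -/

/-- For `p u - p v = (a, b)`, the entries of the row of an edge oriented from `u` to `v` in the
two columns of `u`: `(b, -a)` for a direction edge and `(a, b)` for a length edge. -/
def edgeVec {α : Type*} (p : α → Plane) (e : Edge α) (u v : α) : Fin 2 → ℝ :=
  match e with
  | Sum.inl _ => ![(p u - p v) 1, -(p u - p v) 0]
  | Sum.inr _ => ![(p u - p v) 0, (p u - p v) 1]

/-- The row of the rigidity matrix `R(G, p)` that belongs to the edge `e`. The columns are indexed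
by `V × {0, 1}`, and the edge has the reference orientation from the first to the second component
of the chosen pair `Quot.out e.ends`. -/
noncomputable def rigidityRow {α : Type*} [DecidableEq α] (G : MixedGraph α) (p : α → Plane)
    (e : Edge α) : G.V × Fin 2 → ℝ :=
  let u := (Quot.out e.ends).1
  let v := (Quot.out e.ends).2
  fun x => (if (x.1 : α) = u then edgeVec p e u v x.2 else 0) -
    (if (x.1 : α) = v then edgeVec p e u v x.2 else 0)

/-- Augmentation for finite families of vectors. -/
theorem exists_linearIndepOn_insert {ι W : Type*} [AddCommGroup W] [Module ℝ W] {v : ι → W}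
    {I J : Set ι} (hIfin : I.Finite) (hJfin : J.Finite) (hI : LinearIndepOn ℝ v I)
    (hJ : LinearIndepOn ℝ v J) (hlt : I.ncard < J.ncard) :
    ∃ e ∈ J, e ∉ I ∧ LinearIndepOn ℝ v (insert e I) := by
  classical
  by_contra! hcon
  have hspan : ∀ e ∈ J, v e ∈ Submodule.span ℝ (v '' I) := by
    intro e he
    by_cases heI : e ∈ I
    · exact Submodule.subset_span ⟨e, heI, rfl⟩
    · by_contra hne
      exact hcon e he heI (hI.insert hne)
  have hle : Submodule.span ℝ (v '' J) ≤ Submodule.span ℝ (v '' I) := by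
    rw [Submodule.span_le]
    rintro _ ⟨e, he, rfl⟩
    exact hspan e he
  have hfinI : (v '' I).Finite := hIfin.image v
  have : FiniteDimensional ℝ (Submodule.span ℝ (v '' I)) :=
    FiniteDimensional.span_of_finite ℝ hfinI
  have hmono := Submodule.finrank_mono hle
  have hcard : ∀ {K : Set ι}, K.Finite → LinearIndepOn ℝ v K →
      Module.finrank ℝ (Submodule.span ℝ (v '' K)) = K.ncard := by
    intro K hKfin hK
    have : Fintype K := hKfin.fintype
    have h := finrank_span_eq_card (R := ℝ) (b := fun x : K => v x) hK
    rw [Set.image_eq_range, h, ← Nat.card_eq_fintype_card, Nat.card_coe_set_eq]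
  rw [hcard hIfin hI, hcard hJfin hJ] at hmono
  omega

/-- The rigidity matroid of the framework `(G, p)`: its ground set is the edge set of `G`, and a
set of edges is independent when the corresponding rows of the rigidity matrix are linearly
independent. -/
noncomputable def frameworkMatroid {α : Type*} [DecidableEq α] (G : MixedGraph α)
    (p : α → Plane) : Matroid (Edge α) :=
  (IndepMatroid.ofFinite (E := (G.edges : Set (Edge α))) G.edges.finite_toSet
    (fun F => F ⊆ (G.edges : Set (Edge α)) ∧ LinearIndepOn ℝ (G.rigidityRow p) F)
    ⟨Set.empty_subset _, linearIndepOn_empty ℝ _⟩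
    (fun _ _ hJ hIJ => ⟨hIJ.trans hJ.1, hJ.2.mono hIJ⟩)
    (fun I J hI hJ hlt => by
      obtain ⟨e, heJ, heI, he⟩ := exists_linearIndepOn_insert
        (G.edges.finite_toSet.subset hI.1) (G.edges.finite_toSet.subset hJ.1) hI.2 hJ.2 hlt
      exact ⟨e, heJ, heI, Set.insert_subset (hJ.1 heJ) hI.1, he⟩)
    (fun _ hI => hI.1)).matroid

/-- `F` is independent in the rigidity matroid `M(G)` of `G`, the common rigidity matroid of all
generic realisations of `G`. -/
def IsMIndep {α : Type*} [DecidableEq α] (G : MixedGraph α) (F : Set (Edge α)) : Prop :=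
  ∀ p : α → Plane, G.IsGeneric p → (G.frameworkMatroid p).Indep F

/-- `C` is a circuit of the rigidity matroid `M(G)` of `G`. -/
def IsMCircuit {α : Type*} [DecidableEq α] (G : MixedGraph α) (C : Set (Edge α)) : Prop :=
  ∀ p : α → Plane, G.IsGeneric p → (G.frameworkMatroid p).IsCircuit C

/-- `G` is direction-independent: `D` is independent in the rigidity matroid of `G`. -/
def IsDirectionIndependent {α : Type*} [DecidableEq α] (G : MixedGraph α) : Prop :=
  G.IsMIndep (Sum.inl '' (G.D : Set (Sym2 α)))

/-- A set of edges is direction-pure if all its members are direction edges. -/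
def DirectionPure {α : Type*} (F : Set (Edge α)) : Prop :=
  ∀ e ∈ F, e.isLeft = true

/-! ### Contraction and spanning trees -/

/-- The mixed graph `G` as a multigraph with edge set `G.edges`. -/
def toGraph {α : Type*} (G : MixedGraph α) : Graph α (Edge α) where
  vertexSet := (G.V : Set α)
  edgeSet := (G.edges : Set (Edge α))
  IsLink e x y := e ∈ G.edges ∧ e.ends = s(x, y)
  isLink_symm _ _ := ⟨fun _ _ h => ⟨h.1, h.2.trans Sym2.eq_swap⟩⟩
  eq_or_eq_of_isLink_of_isLink _ x y v w h h' := by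
    have h2 : s(x, y) = s(v, w) := h.2.symm.trans h'.2
    rcases Sym2.eq_iff.1 h2 with h3 | h3
    · exact Or.inl h3.1
    · exact Or.inr h3.1
  edge_mem_iff_exists_isLink e := by
    constructor
    · intro he
      obtain ⟨⟨x, y⟩, hxy⟩ := Quot.exists_rep e.ends
      exact ⟨x, y, he, hxy.symm⟩
    · rintro ⟨x, y, he, -⟩
      exact he
  left_mem_of_isLink e x y h := by
    obtain ⟨he, hxy⟩ := h
    rcases e with e | e
    · exact G.dir_ends e (Finset.inl_mem_disjSum.1 he) x (by
        rw [show e = s(x, y) from hxy]; exact Sym2.mem_mk_left x y)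
    · exact G.len_ends e (Finset.inr_mem_disjSum.1 he) x (by
        rw [show e = s(x, y) from hxy]; exact Sym2.mem_mk_left x y)

/-- The vertex map of the contraction of `H`: all vertices of `H` go to the new vertex `none`. -/
def contractMap {α : Type*} [DecidableEq α] (H : MixedGraph α) (v : α) : Option α :=
  if v ∈ H.V then none else some v

/-- The multigraph `G / H` obtained from `G` by contracting `H` to a single vertex: all edges of
`H` are deleted, and all other edges of `G` are kept, possibly as parallel edges. -/
def contract {α : Type*} [DecidableEq α] (G H : MixedGraph α) : Graph (Option α) (Edge α) :=
  (G.toGraph.deleteEdges (H.edges : Set (Edge α))).map H.contractMap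

end MixedGraph

/-- A multigraph is a tree: it has no loops and no parallel edges, and as a simple graph it is
connected and acyclic. -/
def Graph.IsMultigraphTree {β ε : Type*} (T : Graph β ε) : Prop :=
  T.Simple ∧ T.toSimpleGraph.IsTree

/-- `Γ` is the union of two edge-disjoint spanning trees. -/
def Graph.IsUnionOfTwoSpanningTrees {β ε : Type*} (Γ : Graph β ε) : Prop :=
  ∃ T₁ T₂ : Graph β ε, T₁.IsSpanningSubgraph Γ ∧ T₂.IsSpanningSubgraph Γ ∧
    T₁.IsMultigraphTree ∧ T₂.IsMultigraphTree ∧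
    Disjoint T₁.edgeSet T₂.edgeSet ∧ T₁.edgeSet ∪ T₂.edgeSet = Γ.edgeSet

namespace MixedGraph

/-- First reduction: `H = G - e` for a direction edge `e` that belongs to a direction-pure circuit
of the rigidity matroid of `G`. -/
def DirectionReductionDelete {α : Type*} [DecidableEq α] (G H : MixedGraph α) : Prop :=
  ∃ e ∈ G.D, (∃ C : Set (Edge α), G.IsMCircuit C ∧ DirectionPure C ∧ Sum.inl e ∈ C) ∧
    H = G.deleteDir e

/-- Second reduction: `H` is a proper induced subgraph of `G`, and `G / H` is direction-pure and is
the union of two edge-disjoint spanning trees. -/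
def DirectionReductionContract {α : Type*} [DecidableEq α] (G H : MixedGraph α) : Prop :=
  H.IsProperInducedSubgraph G ∧ DirectionPure (G.contract H).edgeSet ∧
    (G.contract H).IsUnionOfTwoSpanningTrees

/-- `G` is direction reducible to `H`, i.e. `G` admits a direction reduction to `H`. -/
def DirectionReducibleTo {α : Type*} [DecidableEq α] (G H : MixedGraph α) : Prop :=
  G.DirectionReductionDelete H ∨ G.DirectionReductionContract H

end MixedGraph

/-! Write `W` for the vertices outside `H`, so that `G / H` has `|W| + 1` vertices. Two
edge-disjoint spanning trees have `2|W|` edges altogether, and direction-purity of `G / H` puts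
every length edge in `H`; this is the forward implication. Deleting an edge never yields an induced
subgraph. For the converse, take a displacement supported on `W` that satisfies the linearised
direction constraints. All length edges lie in `H`, which does not move, and direction constraints
are linear, so small multiples of the displacement give equivalent frameworks. Rigidity therefore
forces the displacement to vanish (`displacement_eq_zero`). Hence the `2|W|` direction edges outside
`H` form a nonsingular square system in the two coordinates of the displacement. Each row is the sum
of its two coordinate parts, and a nonzero term in the multilinear expansion of the determinant
assigns each edge to one coordinate (`Matrix.exists_split_of_forall_eq_zero`). In each class the
reduced incidence vectors of `G / H` span, so the class is connected; counting gives it exactly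
`|W|` edges, so it is a spanning tree. -/

/-! ### Splitting a nonsingular system of two-dimensional constraints -/

/-- A system of `2 * |W|` equations `b e * (x e ⬝ᵥ f) = a e * (x e ⬝ᵥ g)` in `f` and `g` with only
the trivial solution splits into two halves, on each of which the vectors `x e` span. -/
theorem Matrix.exists_split_of_forall_eq_zero {E W : Type*} [Fintype E] [Fintype W]
    (x : E → W → ℝ) (a b : E → ℝ) (hcard : Fintype.card E = 2 * Fintype.card W)
    (hinj : ∀ f g : W → ℝ, (∀ e, b e * (x e ⬝ᵥ f) - a e * (x e ⬝ᵥ g) = 0) → f = 0 ∧ g = 0) :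
    ∃ S : Set E, (∀ f : W → ℝ, (∀ e ∈ S, x e ⬝ᵥ f = 0) → f = 0) ∧
      (∀ f : W → ℝ, (∀ e ∈ Sᶜ, x e ⬝ᵥ f = 0) → f = 0) := by
  classical
  have hcard' : Fintype.card (W ⊕ W) = Fintype.card E := by
    rw [Fintype.card_sum, hcard, two_mul]
  let φ : W ⊕ W ≃ E := Fintype.equivOfCardEq hcard'
  -- The row of an edge is cut into its `f`-part `m` and its `g`-part `m'`.
  let m : W ⊕ W → W ⊕ W → ℝ := fun i => Sum.elim (b (φ i) • x (φ i)) 0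
  let m' : W ⊕ W → W ⊕ W → ℝ := fun i => Sum.elim 0 (-a (φ i) • x (φ i))
  have hdet : Matrix.det (Matrix.of (m + m')) ≠ 0 := by
    intro h0
    obtain ⟨v, hv, hmv⟩ := Matrix.exists_mulVec_eq_zero_iff.2 h0
    apply hv
    have hz := hinj (v ∘ Sum.inl) (v ∘ Sum.inr) (fun e => by
      have h := congrFun hmv (φ.symm e)
      simp only [Matrix.mulVec, dotProduct, Fintype.sum_sum_type, Matrix.of_apply, Pi.add_apply,
        m, m', Sum.elim_inl, Sum.elim_inr, Equiv.apply_symm_apply, Pi.smul_apply, Pi.zero_apply,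
        smul_eq_mul, add_zero, zero_add, mul_assoc, ← Finset.mul_sum, neg_mul] at h
      simp only [dotProduct, Function.comp_apply]
      rw [Finset.sum_neg_distrib, ← Finset.mul_sum] at h
      linarith)
    ext (w | w)
    · exact congrFun hz.1 w
    · exact congrFun hz.2 w
  -- Multilinearity in the rows: each term keeps the `f`-part on `s` and the `g`-part off `s`.
  have hsum : Matrix.det (Matrix.of (m + m')) =
      ∑ s : Finset (W ⊕ W), Matrix.det (Matrix.of (s.piecewise m m')) :=
    (Matrix.detRowAlternating (R := ℝ) (n := W ⊕ W)).toMultilinearMap.map_add_univ m m'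
  rw [hsum] at hdet
  obtain ⟨s, -, hs⟩ := Finset.exists_ne_zero_of_sum_ne_zero hdet
  have hker : ∀ v : W ⊕ W → ℝ, (Matrix.of (s.piecewise m m')).mulVec v = 0 → v = 0 := by
    intro v hv
    by_contra hne
    exact hs (Matrix.exists_mulVec_eq_zero_iff.1 ⟨v, hne, hv⟩)
  refine ⟨{e | φ.symm e ∈ s}, fun f hf => ?_, fun f hf => ?_⟩
  -- On `(f, 0)` the rows off `s` vanish automatically, so only the conditions on `s` remain.
  · have h := hker (Sum.elim f 0) (by
      ext i
      by_cases hi : i ∈ s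
      · have hx : ∑ w, x (φ i) w * f w = 0 := hf (φ i) (by simpa using hi)
        simp [Matrix.mulVec, dotProduct, hi, m, mul_assoc, ← Finset.mul_sum, hx]
      · simp [Matrix.mulVec, dotProduct, hi, m'])
    ext w
    exact congrFun h (Sum.inl w)
  · have h := hker (Sum.elim 0 f) (by
      ext i
      by_cases hi : i ∈ s
      · simp [Matrix.mulVec, dotProduct, hi, m]
      · have hx : ∑ w, x (φ i) w * f w = 0 := hf (φ i) (by simpa using hi)
        simp [Matrix.mulVec, dotProduct, hi, m', mul_assoc, ← Finset.mul_sum, hx])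
    ext w
    exact congrFun h (Sum.inr w)

/-- If the only vector orthogonal to all `x e` with `e ∈ S` is zero, then `S` has at least as many
elements as there are coordinates. -/
theorem Matrix.card_le_ncard_of_forall_eq_zero {E W : Type*} [Finite E] [Fintype W]
    (x : E → W → ℝ) (S : Set E) (h : ∀ f : W → ℝ, (∀ e ∈ S, x e ⬝ᵥ f = 0) → f = 0) :
    Fintype.card W ≤ S.ncard := by
  classical
  have := Fintype.ofFinite E
  let A : Matrix S W ℝ := Matrix.of fun e => x e
  have hA : Function.Injective A.mulVecLin := by
    rw [← LinearMap.ker_eq_bot, LinearMap.ker_eq_bot']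
    intro f hf
    exact h f fun e he => congrFun hf ⟨e, he⟩
  have := LinearMap.finrank_le_finrank_of_injective hA
  rwa [Module.finrank_fintype_fun_eq_card, Module.finrank_fintype_fun_eq_card,
    ← Nat.card_eq_fintype_card (α := S), Nat.card_coe_set_eq] at this

/-! ### Trees as multigraphs -/

namespace Graph

/-- In a loopless multigraph, every edge has an underlying edge of the simple graph, and every edge
of the simple graph arises in this way. -/
theorem exists_surjective_edgeSet_toSimpleGraph {β ε : Type*} (T : Graph β ε) [T.Loopless] :
    ∃ F : T.edgeSet → T.toSimpleGraph.edgeSet, Function.Surjective F ∧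
      ∀ (e : T.edgeSet) (u v : T.vertexSet), (F e : Sym2 T.vertexSet) = s(u, v) ↔
        T.IsLink e u v := by
  have hex : ∀ e : T.edgeSet, ∃ z : T.toSimpleGraph.edgeSet, ∀ u v : T.vertexSet,
      (z : Sym2 T.vertexSet) = s(u, v) ↔ T.IsLink e u v := by
    rintro ⟨e, he⟩
    obtain ⟨x, y, hxy⟩ := exists_isLink_of_mem_edgeSet he
    refine ⟨⟨s(⟨x, hxy.left_mem⟩, ⟨y, hxy.right_mem⟩), ?_⟩, fun u v => ?_⟩
    · rw [SimpleGraph.mem_edgeSet, toSimpleGraph_adj_iff]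
      exact ⟨e, hxy⟩
    · constructor
      · intro h
        rcases Sym2.eq_iff.1 h with ⟨rfl, rfl⟩ | ⟨rfl, rfl⟩
        · exact hxy
        · exact hxy.symm
      · intro h
        rw [Sym2.eq_iff]
        rcases T.eq_or_eq_of_isLink_of_isLink hxy h with h1 | h1
        · subst h1
          exact Or.inl ⟨rfl, Subtype.ext (hxy.right_unique h)⟩
        · subst h1
          exact Or.inr ⟨rfl, Subtype.ext (hxy.right_unique h.symm)⟩
  choose F hF using hex
  refine ⟨F, ?_, hF⟩
  rintro ⟨z, hz⟩
  induction z with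
  | h u v =>
    have hadj := hz
    rw [SimpleGraph.mem_edgeSet, toSimpleGraph_adj_iff] at hadj
    obtain ⟨e, he⟩ := hadj
    exact ⟨⟨e, he.edge_mem⟩, Subtype.ext ((hF _ u v).2 he)⟩

/-- A tree has one edge less than it has vertices. -/
theorem IsMultigraphTree.ncard_edgeSet_add_one {β ε : Type*} {T : Graph β ε}
    (hT : T.IsMultigraphTree) (hfin : T.vertexSet.Finite) :
    T.edgeSet.ncard + 1 = T.vertexSet.ncard := by
  classical
  have := hT.1
  have : Finite T.vertexSet := hfin
  obtain ⟨F, hsurj, hF⟩ := T.exists_surjective_edgeSet_toSimpleGraph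
  have hinj : Function.Injective F := by
    rintro e f hef
    obtain ⟨u, v, huv⟩ := Sym2.exists.1 ⟨(F e : Sym2 T.vertexSet), rfl⟩
    exact Subtype.ext (((hF e u v).1 huv).eq ((hF f u v).1 (hef ▸ huv)))
  have h := (SimpleGraph.isTree_iff_connected_and_card.1 hT.2).2
  rwa [← Nat.card_congr (Equiv.ofBijective F ⟨hinj, hsurj⟩), Nat.card_coe_set_eq,
    Nat.card_coe_set_eq] at h

/-- A connected loopless multigraph with at most `n` edges on `n + 1` vertices is a tree. -/
theorem isMultigraphTree_of_connected {β ε : Type*} {T : Graph β ε} [T.Loopless]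
    (hV : T.vertexSet.Finite) (hE : T.edgeSet.Finite)
    (hcard : T.edgeSet.ncard + 1 ≤ T.vertexSet.ncard) (hconn : T.toSimpleGraph.Connected) :
    T.IsMultigraphTree := by
  classical
  have : Finite T.vertexSet := hV
  have : Finite T.edgeSet := hE
  obtain ⟨F, hsurj, hF⟩ := T.exists_surjective_edgeSet_toSimpleGraph
  -- Connectedness bounds the simple edges from below, the hypothesis bounds the multigraph edges
  -- from above, so no two edges are parallel.
  have h1 := hconn.card_vert_le_card_edgeSet_add_one
  have h2 : Nat.card T.toSimpleGraph.edgeSet ≤ Nat.card T.edgeSet :=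
    Nat.card_le_card_of_surjective F hsurj
  rw [← Nat.card_coe_set_eq, ← Nat.card_coe_set_eq] at hcard
  have hbij : Function.Bijective F :=
    (Nat.bijective_iff_surjective_and_card F).2 ⟨hsurj, by omega⟩
  refine ⟨⟨fun e f x y he hf => ?_⟩, ?_⟩
  · have h : F ⟨e, he.edge_mem⟩ = F ⟨f, hf.edge_mem⟩ := Subtype.ext
      (((hF _ ⟨x, he.left_mem⟩ ⟨y, he.right_mem⟩).2 he).trans
        ((hF _ ⟨x, he.left_mem⟩ ⟨y, he.right_mem⟩).2 hf).symm)
    exact congrArg Subtype.val (hbij.1 h)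
  · rw [SimpleGraph.isTree_iff_connected_and_card]
    exact ⟨hconn, by omega⟩

end Graph

namespace MixedGraph

variable {α : Type*}

/-! ### Displacements of rigid frameworks -/

/-- A displacement of a rigid framework that preserves the direction constraints to first order,
and fixes a vertex and the ends of all length edges, is zero. -/
theorem IsRigidFramework.displacement_eq_zero {G : MixedGraph α} {p : α → Plane}
    (hp : G.IsRigidFramework p) (d : α → Plane) {x₀ : α} (hx₀ : x₀ ∈ G.V) (hd₀ : d x₀ = 0)
    (hL : ∀ u v, s(u, v) ∈ G.L → d u = 0 ∧ d v = 0)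
    (hD : ∀ u v, s(u, v) ∈ G.D →
      (p u - p v) 1 * (d u - d v) 0 - (p u - p v) 0 * (d u - d v) 1 = 0) :
    ∀ v ∈ G.V, d v = 0 := by
  obtain ⟨ε, hε, hrig⟩ := hp
  intro v hv
  obtain ⟨t, ht, hsmall⟩ : ∃ t : ℝ, 0 < t ∧ ∀ w ∈ G.V, t * ‖d w‖ < ε := by
    have hs : 0 ≤ ∑ w ∈ G.V, ‖d w‖ := Finset.sum_nonneg fun _ _ => norm_nonneg _
    refine ⟨ε / (∑ w ∈ G.V, ‖d w‖ + 1), by positivity, fun w hw => ?_⟩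
    have hle : ‖d w‖ ≤ ∑ w ∈ G.V, ‖d w‖ :=
      Finset.single_le_sum (f := fun w => ‖d w‖) (fun _ _ => norm_nonneg _) hw
    rw [div_mul_eq_mul_div, div_lt_iff₀ (by positivity)]
    exact mul_lt_mul_of_pos_left (by linarith) hε
  -- Since `x₀` is fixed, congruence by translation gives `d v = 0`, while the point reflection
  -- prescribes the value of `r • d v`. The latter cannot hold for both `t` and `t / 2` unless `d v
  -- = 0`.
  have hkey : ∀ r : ℝ, 0 < r → r ≤ t → d v = 0 ∨ r • d v = (-2 : ℝ) • (p v - p x₀) := by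
    intro r hr hrt
    have hcong := hrig (fun w => p w + r • d w) ⟨fun u w huw hne => ?_, fun u w huw => ?_⟩
      (fun w hw => ?_)
    · rcases hcong with h | h
      · left
        have h1 := h v hv x₀ hx₀
        simp only [hd₀, smul_zero, add_zero] at h1
        have h2 : r • d v = 0 := by
          have h3 : p v + r • d v - p x₀ - (p v - p x₀) = 0 := by rw [h1, sub_self]
          rw [← h3]; abel
        exact (smul_eq_zero.1 h2).resolve_left hr.ne'
      · right
        have h1 := h v hv x₀ hx₀
        simp only [hd₀, smul_zero, add_zero] at h1
        have h2 : r • d v = -(p x₀ - (p v + r • d v)) - (p v - p x₀) := by abel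
        rw [h2, ← h1, neg_smul, two_smul]
        abel
    · by_cases h0 : p u = p w
      · exact ⟨0, by simp [h0]⟩
      have hc := hD u w huw
      -- The linear constraint says that `d u - d w` is parallel to the nonzero vector `p u - p w`;
      -- divide by a nonzero coordinate.
      obtain ⟨s, hs⟩ : ∃ s : ℝ, d u - d w = s • (p u - p w) := by
        have hne' : (p u - p w) 0 ≠ 0 ∨ (p u - p w) 1 ≠ 0 := by
          by_contra! hcon
          apply h0
          rw [← sub_eq_zero]
          ext i
          fin_cases i
          · exact hcon.1
          · exact hcon.2
        rcases hne' with h1 | h1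
        · refine ⟨(d u - d w) 0 / (p u - p w) 0, ?_⟩
          ext i
          fin_cases i
          · simp only [PiLp.smul_apply, smul_eq_mul, Fin.zero_eta]
            field_simp
          · simp only [PiLp.smul_apply, smul_eq_mul, Fin.mk_one]
            rw [div_mul_eq_mul_div, eq_div_iff h1]
            linarith
        · refine ⟨(d u - d w) 1 / (p u - p w) 1, ?_⟩
          ext i
          fin_cases i
          · simp only [PiLp.smul_apply, smul_eq_mul, Fin.zero_eta]
            rw [div_mul_eq_mul_div, eq_div_iff h1]
            linarith
          · simp only [PiLp.smul_apply, smul_eq_mul, Fin.mk_one]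
            field_simp
      have hq : p u + r • d u - (p w + r • d w) = (1 + r * s) • (p u - p w) := by
        rw [add_smul, one_smul, mul_smul, ← hs, smul_sub]
        abel
      have hns : 1 + r * s ≠ 0 := by
        intro h1
        rw [h1, zero_smul, sub_eq_zero] at hq
        exact hne hq
      refine ⟨(1 + r * s)⁻¹, ?_⟩
      change p u - p w = (1 + r * s)⁻¹ • (p u + r • d u - (p w + r • d w))
      rw [hq, smul_smul, inv_mul_cancel₀ hns, one_smul]
    · simp [hL u w huw]
    · rw [sub_add_cancel_left, norm_neg, norm_smul, Real.norm_of_nonneg hr.le]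
      exact (mul_le_mul_of_nonneg_right hrt (norm_nonneg _)).trans_lt (hsmall w hw)
  rcases hkey t ht le_rfl with h | h
  · exact h
  rcases hkey (t / 2) (by linarith) (by linarith) with h' | h'
  · exact h'
  have h2 : (t - t / 2) • d v = 0 := by rw [sub_smul, h, h', sub_self]
  exact (smul_eq_zero.1 h2).resolve_left (by linarith)

/-! ### The contraction of an induced subgraph -/

variable [DecidableEq α]

theorem contract_isLink {G H : MixedGraph α} {e : Edge α} {x y : Option α} :
    (G.contract H).IsLink e x y ↔ ∃ u v, (e ∈ G.edges ∧ e.ends = s(u, v)) ∧ e ∉ H.edges ∧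
      H.contractMap u = x ∧ H.contractMap v = y := by
  simp only [contract, Graph.map_isLink, Relation.Map, Graph.deleteEdges_isLink, toGraph,
    Finset.mem_coe, and_assoc]

theorem contract_edgeSet (G H : MixedGraph α) :
    (G.contract H).edgeSet = (G.edges : Set (Edge α)) \ (H.edges : Set (Edge α)) := by
  simp [contract, toGraph]

theorem contract_edgeSet_of_len_eq {G H : MixedGraph α} (hL : H.L = G.L) :
    (G.contract H).edgeSet = Sum.inl '' ((G.D \ H.D : Finset (Sym2 α)) : Set (Sym2 α)) := by
  rw [contract_edgeSet]
  ext (e | e) <;> simp [edges, hL]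

theorem contract_vertexSet {G H : MixedGraph α} (hV : H.V ⊆ G.V) :
    (G.contract H).vertexSet =
      insert none (some '' ((G.V \ H.V : Finset α) : Set α)) := by
  ext x
  simp only [contract, Graph.vertexSet_map, Graph.vertexSet_deleteEdges, toGraph, contractMap,
    Set.mem_image, Finset.mem_coe, Set.mem_insert_iff, Finset.mem_sdiff]
  constructor
  · rintro ⟨v, hv, rfl⟩
    by_cases hvH : v ∈ H.V <;> simp [hv, hvH]
  · rintro (rfl | ⟨v, ⟨hv, hvH⟩, rfl⟩)
    · obtain ⟨v, hv⟩ := H.nonempty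
      exact ⟨v, hV hv, by simp [hv]⟩
    · exact ⟨v, hv, by simp [hvH]⟩

theorem finite_contract_vertexSet {G H : MixedGraph α} (hV : H.V ⊆ G.V) :
    (G.contract H).vertexSet.Finite := by
  rw [contract_vertexSet hV]
  exact ((Finset.finite_toSet _).image _).insert _

theorem ncard_contract_vertexSet {G H : MixedGraph α} (hV : H.V ⊆ G.V) :
    (G.contract H).vertexSet.ncard = (G.V \ H.V).card + 1 := by
  rw [contract_vertexSet hV, Set.ncard_insert_of_notMem (by simp)
    ((Finset.finite_toSet _).image _), Set.ncard_image_of_injective _ (Option.some_injective _),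
    Set.ncard_coe_finset]

/-- A loop could only come from an edge with both ends in `H`; as `H` is induced, such an edge
belongs to `H` and is deleted. -/
theorem IsInducedSubgraph.loopless_contract {G H : MixedGraph α} (hH : H.IsInducedSubgraph G) :
    (G.contract H).Loopless := by
  rw [Graph.loopless_iff_forall_ne_of_adj]
  rintro x y ⟨e, hlink⟩ hxy
  obtain ⟨u, v, ⟨he, huv⟩, heH, rfl, rfl⟩ := contract_isLink.1 hlink
  have hne : u ≠ v := by
    rintro rfl
    rcases e with e | e
    · exact G.dir_not_isDiag e (Finset.inl_mem_disjSum.1 he) (by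
        rw [show e = s(u, u) from huv]; exact Sym2.mk_isDiag_iff.2 rfl)
    · exact G.len_not_isDiag e (Finset.inr_mem_disjSum.1 he) (by
        rw [show e = s(u, u) from huv]; exact Sym2.mk_isDiag_iff.2 rfl)
  unfold contractMap at hxy
  by_cases hu : u ∈ H.V
  · by_cases hv : v ∈ H.V
    · apply heH
      have hends : ∀ w ∈ s(u, v), w ∈ H.V := by
        intro w hw
        rcases Sym2.mem_iff.1 hw with rfl | rfl <;> assumption
      rcases e with e | e
      · obtain rfl : e = s(u, v) := huv
        exact Finset.inl_mem_disjSum.2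
          ((hH.mem_dir_iff _).2 ⟨Finset.inl_mem_disjSum.1 he, hends⟩)
      · obtain rfl : e = s(u, v) := huv
        exact Finset.inr_mem_disjSum.2
          ((hH.mem_len_iff _).2 ⟨Finset.inr_mem_disjSum.1 he, hends⟩)
    · simp [hu, hv] at hxy
  · by_cases hv : v ∈ H.V
    · simp [hu, hv] at hxy
    · simp [hu, hv, hne] at hxy

/-! ### Spanning trees of the contraction -/

/-- A set `F` of direction edges outside `H` of size at most
`|V \ V'|` such that every vertex function that vanishes on `H` and is constant along the edges of
`F` vanishes, is the edge set of a spanning tree of `G / H`. -/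
theorem IsInducedSubgraph.isMultigraphTree_restrict {G H : MixedGraph α}
    (hH : H.IsInducedSubgraph G) {F : Finset (Sym2 α)} (hF : F ⊆ G.D \ H.D)
    (hcard : F.card ≤ (G.V \ H.V).card)
    (hinj : ∀ f : α → ℝ, (∀ v ∉ G.V \ H.V, f v = 0) → (∀ u v, s(u, v) ∈ F → f u = f v) →
      f = 0) :
    ((G.contract H).restrict (Sum.inl '' (F : Set (Sym2 α)))).IsMultigraphTree := by
  classical
  set T := (G.contract H).restrict (Sum.inl '' (F : Set (Sym2 α))) with hTdef
  have hle : T ≤ G.contract H := Graph.restrict_le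
  have : (G.contract H).Loopless := hH.loopless_contract
  have : T.Loopless := Graph.Loopless.anti hle
  have hVT : T.vertexSet = (G.contract H).vertexSet := rfl
  have hET : T.edgeSet ⊆ Sum.inl '' (F : Set (Sym2 α)) := Set.inter_subset_right
  have hfin : (Sum.inl '' (F : Set (Sym2 α)) : Set (Edge α)).Finite := F.finite_toSet.image _
  have hnone : none ∈ T.vertexSet := by
    rw [hVT, contract_vertexSet hH.verts_subset]
    exact Set.mem_insert _ _
  have hmem : ∀ v ∈ G.V \ H.V, some v ∈ T.vertexSet := by
    intro v hv
    rw [hVT, contract_vertexSet hH.verts_subset]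
    exact Or.inr ⟨v, hv, rfl⟩
  have hreach : ∀ v : T.vertexSet, T.toSimpleGraph.Reachable ⟨none, hnone⟩ v := by
    let P : Option α → Prop := fun x => ∃ h : x ∈ T.vertexSet,
      ¬ T.toSimpleGraph.Reachable ⟨none, hnone⟩ ⟨x, h⟩
    have hPnone : ¬ P none := fun ⟨_, h⟩ => h (SimpleGraph.Reachable.refl _)
    have hPlink : ∀ e x y, T.IsLink e x y → (P x ↔ P y) := by
      have haux : ∀ e x y, T.IsLink e x y → P x → P y := by
        rintro e x y hxy ⟨hx, hnx⟩
        refine ⟨hxy.right_mem, fun hy => hnx (hy.trans ?_)⟩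
        apply SimpleGraph.Adj.reachable
        rw [Graph.toSimpleGraph_adj_iff]
        exact ⟨e, hxy.symm⟩
      exact fun e x y hxy => ⟨haux e x y hxy, haux e y x hxy.symm⟩
    -- The indicator of the vertices not reachable from the contracted vertex vanishes on `H` and is
    -- constant along `F`, so it is zero.
    let f : α → ℝ := fun v => if P (H.contractMap v) then 1 else 0
    have hf : f = 0 := by
      apply hinj
      · intro v hv
        refine if_neg fun hPv => ?_
        by_cases hvH : v ∈ H.V
        · rw [contractMap, if_pos hvH] at hPv
          exact hPnone hPv
        · rw [contractMap, if_neg hvH] at hPv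
          obtain ⟨hx, -⟩ := hPv
          rw [hVT, contract_vertexSet hH.verts_subset] at hx
          simp only [Set.mem_insert_iff, reduceCtorEq, Set.mem_image, Option.some.injEq,
            exists_eq_right, false_or, Finset.mem_coe] at hx
          exact hv hx
      · intro u v huv
        have hlink : T.IsLink (Sum.inl s(u, v)) (H.contractMap u) (H.contractMap v) := by
          have hmemD := Finset.mem_sdiff.1 (hF huv)
          rw [hTdef, Graph.restrict_isLink, contract_isLink]
          exact ⟨⟨_, huv, rfl⟩, u, v, ⟨Finset.inl_mem_disjSum.2 hmemD.1, rfl⟩,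
            fun h => hmemD.2 (Finset.inl_mem_disjSum.1 h), rfl, rfl⟩
        simp only [f, hPlink _ _ _ hlink]
    rintro ⟨x, hx⟩
    by_contra hnx
    have hx' := hx
    rw [hVT, contract_vertexSet hH.verts_subset] at hx'
    rcases hx' with rfl | ⟨v, hv, rfl⟩
    · exact hnx (SimpleGraph.Reachable.refl _)
    · have hvH : v ∉ H.V := (Finset.mem_sdiff.1 hv).2
      have h1 : f v = 1 := by
        refine if_pos ?_
        rw [contractMap, if_neg hvH]
        exact ⟨hx, hnx⟩
      rw [hf] at h1
      simp at h1
  refine Graph.isMultigraphTree_of_connected (hVT ▸ finite_contract_vertexSet hH.verts_subset)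
    (hfin.subset hET) ?_ ?_
  · rw [hVT, ncard_contract_vertexSet hH.verts_subset]
    have h1 := Set.ncard_le_ncard hET hfin
    rw [Set.ncard_image_of_injective _ Sum.inl_injective, Set.ncard_coe_finset] at h1
    omega
  · have : Nonempty T.vertexSet := ⟨⟨none, hnone⟩⟩
    exact ⟨fun u v => (hreach u).symm.trans (hreach v)⟩

/-- If `G` is rigid, `H` contains all length edges and `G` has `2 |V \ V'|` direction edges outside
`H`, then `G / H` is the union of two edge-disjoint spanning trees. -/
theorem IsInducedSubgraph.isUnionOfTwoSpanningTrees_contract {G H : MixedGraph α}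
    (hH : H.IsInducedSubgraph G) {p : α → Plane} (hp : G.IsRigidFramework p) (hL : H.L = G.L)
    (hcard : (G.D \ H.D).card = 2 * (G.V \ H.V).card) :
    (G.contract H).IsUnionOfTwoSpanningTrees := by
  classical
  let E := (G.D \ H.D : Finset (Sym2 α))
  let W := (G.V \ H.V : Finset α)
  -- The incidence vector of `e` in `G / H`, without the column of the contracted vertex.
  let x : E → W → ℝ := fun e w => (if (w : α) = (Quot.out e.1).1 then 1 else 0) -
    (if (w : α) = (Quot.out e.1).2 then 1 else 0)
  let c : Fin 2 → E → ℝ := fun i e => (p (Quot.out e.1).1 - p (Quot.out e.1).2) i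
  have hx : ∀ (e : E) (f : α → ℝ), (∀ v ∉ W, f v = 0) →
      x e ⬝ᵥ (fun w : W => f w) = f (Quot.out e.1).1 - f (Quot.out e.1).2 := by
    intro e f hf
    have haux : ∀ u, ∑ w : W, (if (w : α) = u then f w else 0) = f u := by
      intro u
      rw [Finset.sum_coe_sort W (fun w => if w = u then f w else 0), Finset.sum_ite_eq']
      split_ifs with hu
      · rfl
      · exact (hf u hu).symm
    simp only [dotProduct, x, sub_mul, ite_mul, one_mul, zero_mul, Finset.sum_sub_distrib, haux]
  have hext : ∀ f : W → ℝ, ∃ f' : α → ℝ, (∀ v ∉ W, f' v = 0) ∧ (fun w : W => f' w) = f := by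
    intro f
    refine ⟨fun v => if h : v ∈ W then f ⟨v, h⟩ else 0, fun v hv => dif_neg hv, ?_⟩
    ext w
    exact dif_pos w.2
  have hout : ∀ e : Sym2 α, s((Quot.out e).1, (Quot.out e).2) = e := fun e => Quot.out_eq e
  obtain ⟨S, hS, hSc⟩ := Matrix.exists_split_of_forall_eq_zero x (c 0) (c 1)
    (by simpa only [Fintype.card_coe] using hcard) (by
    intro f g hfg
    obtain ⟨f, hf, rfl⟩ := hext f
    obtain ⟨g, hg, rfl⟩ := hext g
    obtain ⟨x₀, hx₀⟩ := H.nonempty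
    let d : α → Plane := fun v => !₂[f v, g v]
    have hdH : ∀ v ∉ W, d v = 0 := by
      intro v hv
      ext i
      fin_cases i <;> simp [d, hf v hv, hg v hv]
    have hHW : ∀ v ∈ H.V, v ∉ W := fun v hv h => (Finset.mem_sdiff.1 h).2 hv
    have hd := hp.displacement_eq_zero d (hH.verts_subset hx₀) (hdH x₀ (hHW x₀ hx₀)) (by
      intro u v huv
      rw [← hL] at huv
      exact ⟨hdH u (hHW u (H.len_ends _ huv u (Sym2.mem_mk_left u v))),
        hdH v (hHW v (H.len_ends _ huv v (Sym2.mem_mk_right u v)))⟩) (by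
      intro u v huv
      by_cases huvH : s(u, v) ∈ H.D
      · rw [hdH u (hHW u (H.dir_ends _ huvH u (Sym2.mem_mk_left u v))),
          hdH v (hHW v (H.dir_ends _ huvH v (Sym2.mem_mk_right u v)))]
        simp
      · have h := hfg ⟨s(u, v), Finset.mem_sdiff.2 ⟨huv, huvH⟩⟩
        rw [hx _ f hf, hx _ g hg] at h
        simp only [c] at h
        -- Reversing the orientation changes the sign of both factors in each product, so the
        -- equation is unaffected.
        rcases Sym2.eq_iff.1 (hout s(u, v)) with ⟨h1, h2⟩ | ⟨h1, h2⟩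
        · rw [h1, h2] at h
          simpa [d] using h
        · rw [h1, h2] at h
          simp only [PiLp.sub_apply] at h
          simp [d]
          linarith)
    have hdW : ∀ w : W, d w = 0 := fun w => hd w (Finset.mem_sdiff.1 w.2).1
    constructor
    · ext w
      simpa [d] using congrArg (fun z : Plane => z 0) (hdW w)
    · ext w
      simpa [d] using congrArg (fun z : Plane => z 1) (hdW w))
  -- Both halves have at least `|W|` edges and together `2|W|`, so each has exactly `|W|`.
  have h1 := Matrix.card_le_ncard_of_forall_eq_zero x S hS
  have h2 := Matrix.card_le_ncard_of_forall_eq_zero x Sᶜ hSc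
  have h3 := Set.ncard_add_ncard_compl S
  rw [Nat.card_eq_fintype_card, Fintype.card_coe] at h3
  rw [Fintype.card_coe] at h1 h2
  have hEW : E.card = 2 * W.card := hcard
  let F : Set E → Finset (Sym2 α) := fun R => R.toFinite.toFinset.map (Function.Embedding.subtype _)
  have hFmem : ∀ (R : Set E) (e : Sym2 α), e ∈ F R ↔ ∃ h : e ∈ E, (⟨e, h⟩ : E) ∈ R := by
    intro R e
    simp [F]
  have hFcard : ∀ R : Set E, (F R).card = R.ncard := by
    intro R
    rw [Finset.card_map, Set.ncard_eq_toFinset_card R]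
  have htree : ∀ R : Set E, R.ncard ≤ W.card →
      (∀ f : W → ℝ, (∀ e ∈ R, x e ⬝ᵥ f = 0) → f = 0) →
      ((G.contract H).restrict (Sum.inl '' (F R : Set (Sym2 α)))).IsMultigraphTree := by
    intro R hR hRinj
    refine hH.isMultigraphTree_restrict (fun e he => ((hFmem R e).1 he).1)
      ((hFcard R).trans_le hR) (fun f hf hconst => ?_)
    have h := hRinj (fun w => f w) (fun e he => by
      rw [hx e f hf, sub_eq_zero]
      exact hconst _ _ ((hout e.1).symm ▸ (hFmem R e).2 ⟨e.2, he⟩))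
    ext v
    by_cases hv : v ∈ W
    · exact congrFun h ⟨v, hv⟩
    · exact hf v hv
  have hsub : ∀ R : Set E, (Sum.inl '' (F R : Set (Sym2 α)) : Set (Edge α)) ⊆
      (G.contract H).edgeSet := by
    intro R
    rw [contract_edgeSet_of_len_eq hL]
    exact Set.image_mono fun e he => ((hFmem R e).1 he).1
  refine ⟨_, _, ⟨Graph.restrict_le, rfl⟩, ⟨Graph.restrict_le, rfl⟩,
    htree S (by omega) hS, htree Sᶜ (by omega) hSc, ?_, ?_⟩
  · rw [Graph.edgeSet_restrict, Graph.edgeSet_restrict]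
    refine Disjoint.mono Set.inter_subset_right Set.inter_subset_right ?_
    rw [Set.disjoint_image_iff Sum.inl_injective, Set.disjoint_left]
    intro e he he'
    obtain ⟨_, h⟩ := (hFmem _ _).1 he
    obtain ⟨_, h'⟩ := (hFmem _ _).1 he'
    exact h' h
  · rw [Graph.edgeSet_restrict, Graph.edgeSet_restrict, Set.inter_eq_right.2 (hsub _),
      Set.inter_eq_right.2 (hsub _), contract_edgeSet_of_len_eq hL, ← Set.image_union]
    congr 1
    ext e
    constructor
    · rintro (he | he) <;> exact ((hFmem _ _).1 he).1
    · intro he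
      by_cases h : (⟨e, he⟩ : E) ∈ S
      · exact Or.inl ((hFmem _ _).2 ⟨he, h⟩)
      · exact Or.inr ((hFmem _ _).2 ⟨he, h⟩)

end MixedGraph

/-! ### Edge count and the equivalence -/

theorem Graph.IsUnionOfTwoSpanningTrees.ncard_edgeSet {β ε : Type*} {Γ : Graph β ε}
    (hΓ : Γ.IsUnionOfTwoSpanningTrees) (hV : Γ.vertexSet.Finite) (hE : Γ.edgeSet.Finite) :
    Γ.edgeSet.ncard + 2 = 2 * Γ.vertexSet.ncard := by
  obtain ⟨T₁, T₂, hs₁, hs₂, ht₁, ht₂, hdisj, hunion⟩ := hΓ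
  have h₁ := ht₁.ncard_edgeSet_add_one (hs₁.vertexSet_eq ▸ hV)
  have h₂ := ht₂.ncard_edgeSet_add_one (hs₂.vertexSet_eq ▸ hV)
  rw [hs₁.vertexSet_eq] at h₁
  rw [hs₂.vertexSet_eq] at h₂
  rw [← hunion, Set.ncard_union_eq hdisj (hE.subset (hunion ▸ Set.subset_union_left))
    (hE.subset (hunion ▸ Set.subset_union_right))]
  omega

theorem mainTheorem11 {α : Type*} [DecidableEq α] (G H : MixedGraph α)
    (hrigid : G.IsRigid) (hindep : G.IsDirectionIndependent)
    (hH : H.IsProperInducedSubgraph G) :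
    G.DirectionReducibleTo H ↔
      H.L = G.L ∧ (G.D \ H.D).card = 2 * (G.V \ H.V).card := by
  have hI := hH.1
  constructor
  · rintro (⟨e, he, -, rfl⟩ | ⟨-, hpure, htrees⟩)
    -- `G - e` keeps both ends of `e`, so being induced it would have to contain `e`.
    · have h := (hI.mem_dir_iff e).2 ⟨he, fun v hv => G.dir_ends e he v hv⟩
      exact absurd rfl (Finset.ne_of_mem_erase h)
    · have hL : H.L = G.L := by
        ext e
        refine ⟨fun he => ((hI.mem_len_iff e).1 he).1, fun he => ?_⟩
        by_contra hne
        have h := hpure (Sum.inr e) (by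
          rw [MixedGraph.contract_edgeSet]
          simp [MixedGraph.edges, he, hne])
        simp at h
      have hE := MixedGraph.contract_edgeSet_of_len_eq hL
      have h := htrees.ncard_edgeSet (MixedGraph.finite_contract_vertexSet hI.verts_subset)
        (hE ▸ (Finset.finite_toSet _).image _)
      -- The contracted vertex adds 2 on the right, matching the 2 on the left.
      rw [MixedGraph.ncard_contract_vertexSet hI.verts_subset, hE,
        Set.ncard_image_of_injective _ Sum.inl_injective, Set.ncard_coe_finset] at h
      exact ⟨hL, by omega⟩
  · rintro ⟨hL, hcard⟩
    obtain ⟨p, -, hp⟩ := hrigid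
    refine Or.inr ⟨hH, ?_, hI.isUnionOfTwoSpanningTrees_contract hp hL hcard⟩
    rw [MixedGraph.contract_edgeSet_of_len_eq hL]
    rintro _ ⟨e, -, rfl⟩
    rfl
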